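/- Let $k \ge 2$ be an integer. For a finite simple graph $G$, let the maximum average degree $\mathrm{mad}(G)$ be the maximum of $\frac{2|E(H)|}{|V(H)|}$ over all subgraphs $H$ of $G$ with at least one vertex (and $0$ if $G$ has no vertices). If $G$ is a finite simple graph with $$\mathrm{mad}(G) < \frac{8k}{3k+1} = \frac{8}{3}\left(1 - \frac{1}{3k+1}\right),$$ then $G$ admits an $(\mathcal{I},\mathcal{O}_k)$-partition; that is, $V(G)$ can be partitioned into two (possibly empty) sets $I$ and $O$ such that $I$ is an independent set of $G$ and every connected component of the induced subgraph $G[O]$ has at most $k$ vertices. -/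

import Mathlib

namespace SimpleGraph

/-- The maximum average degree of `G`: the supremum of `2|E(H)| / |V(H)|` over all subgraphs `H`
of `G` with at least one vertex. For a finite graph the set below is finite, so the supremum is
a maximum (the value is `0` for the graph without vertices). -/
noncomputable def mad {V : Type*} (G : SimpleGraph V) : ℝ :=
  sSup {d : ℝ | ∃ H : G.Subgraph, H.verts.Nonempty ∧
    d = 2 * (H.edgeSet.ncard : ℝ) / (H.verts.ncard : ℝ)}

/-- The class `𝓘` of edgeless graphs. -/
def IsEdgeless {V : Type*} (G : SimpleGraph V) : Prop :=
  ∀ u v : V, ¬ G.Adj u v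

/-- The class `𝓞ₖ` of graphs all of whose components have order at most `k`. -/
def ComponentsOrderLE {V : Type*} (G : SimpleGraph V) (k : ℕ) : Prop :=
  ∀ c : G.ConnectedComponent, c.supp.encard ≤ (k : ℕ∞)

/-- `G` admits an `(𝓘, 𝓞ₖ)`-partition: the vertex set is the disjoint union of two (possibly
empty) sets `I` and `O` with `G[I]` edgeless and every component of `G[O]` of order at most `k`. -/
def AdmitsIOPartition {V : Type*} (G : SimpleGraph V) (k : ℕ) : Prop :=
  ∃ I O : Set V, I ∪ O = Set.univ ∧ Disjoint I O ∧
    (G.induce I).IsEdgeless ∧ (G.induce O).ComponentsOrderLE k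

end SimpleGraph

namespace SimpleGraph

open Finset
open scoped Classical

variable {V : Type*} {G : SimpleGraph V} {k : ℕ} {w : V → ℕ} {A B N P Q S T : Finset V} {u v x z : V}

/-! The result is proved for weighted vertices: a vertex in `O` counts `w v` times towards the bound
`k`, and each unit of weight beyond the first costs `k + 3` in `potential`. With all weights 1, the
bound on `mad` says exactly that nonempty sets have positive potential.

Take a vertex-minimal uncolourable set `A`. It has no isolated vertices, its leaves weigh more than
`k`, and so does a set together with its outer neighbours if these all have degree two
(`lt_weight_of_critical`). Two adjacent vertices of degree two also weigh more than `k` together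
(`lt_weight_add_weight_of_critical`): otherwise they are deleted and the weight of one is moved to
its other neighbour. This is the step that needs weights.

Discharging then contradicts positivity (`potential_nonpos_of_discharging`): the charges sum to `-4`
times the potential of `A`, yet after redistribution they are nonnegative on each vertex of degree
other than three and on each component of the graph of degree-three vertices. -/

/-- The number of neighbours of `v` in `S`. -/
noncomputable def degIn (G : SimpleGraph V) (S : Finset V) (v : V) : ℕ :=
  #{b ∈ S | G.Adj v b}

/-- The number of ordered pairs of adjacent vertices of `S`. -/
noncomputable def adjPairs (G : SimpleGraph V) (S : Finset V) : ℕ :=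
  #{p ∈ S ×ˢ S | G.Adj p.1 p.2}

/-- A weighted `(𝓘, 𝓞ₖ)`-partition of `G[A]`: `none` marks the independent part, and the other
vertices carry a label constant along edges such that every label has total weight at most `k`. -/
structure IsIOColoring (G : SimpleGraph V) (k : ℕ) (w : V → ℕ) (A : Finset V)
    (f : V → Option ℕ) : Prop where
  indep : ∀ a ∈ A, ∀ b ∈ A, G.Adj a b → f a = none → f b ≠ none
  label : ∀ a ∈ A, ∀ b ∈ A, G.Adj a b → f a ≠ none → f b ≠ none → f a = f b
  weight : ∀ i : ℕ, ∑ v ∈ A with f v = some i, w v ≤ k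

/-- Twice the potential of `S` in the weighted graph `(G, w)`. -/
noncomputable def potential (G : SimpleGraph V) (k : ℕ) (w : V → ℕ) (S : Finset V) : ℤ :=
  ∑ v ∈ S, (8 * (k : ℤ) - (k + 3) * ((w v : ℤ) - 1)) - (3 * k + 1) * G.adjPairs S

/-! ### Submodularity of the potential. -/

lemma adjPairs_eq_sum (G : SimpleGraph V) (S : Finset V) :
    G.adjPairs S = ∑ v ∈ S, G.degIn S v := by
  simp only [adjPairs, degIn, card_filter, sum_product]

lemma adjPairs_insert (hu : u ∉ T) :
    G.adjPairs (insert u T) = G.adjPairs T + 2 * G.degIn T u := by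
  have h1 : G.degIn (insert u T) u = G.degIn T u := by
    simp [degIn, filter_insert]
  have h2 : ∀ a ∈ T, G.degIn (insert u T) a = G.degIn T a + if G.Adj u a then 1 else 0 := by
    intro a ha
    simp only [degIn, filter_insert, G.adj_comm u a]
    split_ifs with h
    · rw [card_insert_of_notMem (by simp [hu])]
    · simp
  rw [adjPairs_eq_sum, adjPairs_eq_sum, sum_insert hu, h1, sum_congr rfl h2, sum_add_distrib,
    ← card_filter]
  unfold degIn
  ring

lemma adjPairs_supermodular (G : SimpleGraph V) (S T : Finset V) :
    G.adjPairs S + G.adjPairs T ≤ G.adjPairs (S ∪ T) + G.adjPairs (S ∩ T) := by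
  unfold adjPairs
  rw [← card_union_add_card_inter, ← filter_union, ← filter_inter_distrib,
    product_inter_product]
  gcongr
  intro p hp
  simp only [mem_union, mem_product] at hp ⊢
  tauto

lemma potential_submodular (G : SimpleGraph V) (k : ℕ) (w : V → ℕ) (S T : Finset V) :
    G.potential k w (S ∪ T) + G.potential k w (S ∩ T) ≤
      G.potential k w S + G.potential k w T := by
  have h1 := sum_union_inter (s₁ := S) (s₂ := T)
    (f := fun v => (8 * (k : ℤ) - (k + 3) * ((w v : ℤ) - 1)))
  have h2 : ((G.adjPairs S + G.adjPairs T : ℕ) : ℤ) ≤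
      ((G.adjPairs (S ∪ T) + G.adjPairs (S ∩ T) : ℕ) : ℤ) := by
    exact_mod_cast adjPairs_supermodular G S T
  push_cast at h2
  unfold potential
  have h3 := mul_le_mul_of_nonneg_left h2 (by positivity : (0 : ℤ) ≤ 3 * k + 1)
  linarith

lemma potential_insert (hu : u ∉ T) :
    G.potential k w (insert u T) = G.potential k w T + 8 * k - (k + 3) * ((w u : ℤ) - 1)
      - 2 * (3 * k + 1) * G.degIn T u := by
  unfold potential
  rw [sum_insert hu, adjPairs_insert hu]
  push_cast
  ring

/-! ### Extending colourings. -/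

lemma IsIOColoring.mono_weight {w' : V → ℕ} {f : V → Option ℕ} (hf : G.IsIOColoring k w' A f)
    (h : ∀ v, w v ≤ w' v) : G.IsIOColoring k w A f :=
  ⟨hf.indep, hf.label, fun i => (sum_le_sum fun v _ => h v).trans (hf.weight i)⟩

/-- Extension of a colouring of `B` to `B ∪ N`, the vertices of `P` forming one new part. -/
lemma IsIOColoring.extend {f : V → Option ℕ} (hf : G.IsIOColoring k w B f) (hBN : Disjoint B N)
    (hPN : P ⊆ N) (hI : ∀ a ∈ N, a ∉ P → ∀ b ∈ N, b ∉ P → ¬ G.Adj a b)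
    (hIB : ∀ a ∈ N, a ∉ P → ∀ b ∈ B, G.Adj a b → f b ≠ none)
    (hOB : ∀ a ∈ P, ∀ b ∈ B, G.Adj a b → f b = none) (hP : ∑ v ∈ P, w v ≤ k) :
    ∃ g, G.IsIOColoring k w (B ∪ N) g := by
  -- A label unused by `f`; the default 0 only excludes one more candidate.
  obtain ⟨m, hm⟩ := Infinite.exists_notMem_finset (B.image fun v => (f v).getD 0)
  have hm' : ∀ b ∈ B, f b ≠ some m := fun b hb h =>
    hm (mem_image.2 ⟨b, hb, by simp [h]⟩)
  set g : V → Option ℕ := fun v => if v ∈ P then some m else if v ∈ N then none else f v with hg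
  have gP : ∀ a ∈ P, g a = some m := fun a ha => by simp [hg, ha]
  have gI : ∀ a ∈ N, a ∉ P → g a = none := fun a ha ha' => by simp [hg, ha, ha']
  have gB : ∀ a ∈ B, g a = f a := fun a ha => by
    have h1 : a ∉ N := Finset.disjoint_left.1 hBN ha
    have h2 : a ∉ P := fun h => h1 (hPN h)
    simp [hg, h1, h2]
  have cases : ∀ a ∈ B ∪ N, a ∈ B ∨ a ∈ P ∨ (a ∈ N ∧ a ∉ P) := by
    intro a ha
    rw [mem_union] at ha
    tauto
  refine ⟨g, ?_, ?_, ?_⟩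
  · intro a ha b hb hab h
    rcases cases a ha with ha | ha | ⟨ha, ha'⟩
    · rw [gB a ha] at h
      rcases cases b hb with hb | hb | ⟨hb, hb'⟩
      · rw [gB b hb]; exact hf.indep a ha b hb hab h
      · simp [gP b hb]
      · exact absurd h (hIB b hb hb' a ha hab.symm)
    · simp [gP a ha] at h
    · rcases cases b hb with hb | hb | ⟨hb, hb'⟩
      · rw [gB b hb]; exact hIB a ha ha' b hb hab
      · simp [gP b hb]
      · exact absurd hab (hI a ha ha' b hb hb')
  · intro a ha b hb hab h h'
    rcases cases a ha with ha | ha | ⟨ha, ha'⟩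
    · rcases cases b hb with hb | hb | ⟨hb, hb'⟩
      · rw [gB a ha] at h ⊢
        rw [gB b hb] at h' ⊢
        exact hf.label a ha b hb hab h h'
      · rw [gB a ha] at h
        exact absurd (hOB b hb a ha hab.symm) h
      · exact absurd (gI b hb hb') h'
    · rcases cases b hb with hb | hb | ⟨hb, hb'⟩
      · rw [gB b hb] at h'
        exact absurd (hOB a ha b hb hab) h'
      · rw [gP a ha, gP b hb]
      · exact absurd (gI b hb hb') h'
    · exact absurd (gI a ha ha') h
  · intro i
    by_cases him : i = m
    · subst him
      refine le_trans (sum_le_sum_of_subset ?_) hP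
      intro a ha
      rw [mem_filter] at ha
      rcases cases a ha.1 with h | h | ⟨h, h'⟩
      · exact absurd ((gB a h).symm.trans ha.2) (hm' a h)
      · exact h
      · simp [gI a h h'] at ha
    · refine le_trans (sum_le_sum_of_subset ?_) (hf.weight i)
      intro a ha
      rw [mem_filter] at ha ⊢
      rcases cases a ha.1 with h | h | ⟨h, h'⟩
      · exact ⟨h, (gB a h).symm.trans ha.2⟩
      · have := (gP a h).symm.trans ha.2
        simp only [Option.some.injEq] at this
        exact absurd this.symm him
      · simp [gI a h h'] at ha

lemma exists_unique_neighbor_of_degIn_eq_one (h : G.degIn A v = 1) :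
    ∃ x ∈ A, G.Adj v x ∧ ∀ b ∈ A, G.Adj v b → b = x := by
  obtain ⟨x, hx⟩ := card_eq_one.1 h
  have h1 : ∀ b, b ∈ A ∧ G.Adj v b ↔ b = x := fun b => by
    rw [← mem_filter, hx, mem_singleton]
  exact ⟨x, ((h1 x).2 rfl).1, ((h1 x).2 rfl).2, fun b hb hvb => (h1 b).1 ⟨hb, hvb⟩⟩

lemma exists_other_neighbor_of_degIn_eq_two (h : G.degIn A u = 2) (hv : v ∈ A)
    (huv : G.Adj u v) :
    ∃ x ∈ A, x ≠ v ∧ G.Adj u x ∧ ∀ b ∈ A, G.Adj u b → b = v ∨ b = x := by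
  obtain ⟨x, y, hxy, he⟩ := card_eq_two.1 h
  have h1 : ∀ b, b ∈ A ∧ G.Adj u b ↔ b = x ∨ b = y := fun b => by
    rw [← mem_filter, he, mem_insert, mem_singleton]
  have hx := (h1 x).2 (.inl rfl)
  have hy := (h1 y).2 (.inr rfl)
  rcases (h1 v).1 ⟨hv, huv⟩ with rfl | rfl
  · exact ⟨y, hy.1, hxy.symm, hy.2, fun b hb hvb => (h1 b).1 ⟨hb, hvb⟩⟩
  · exact ⟨x, hx.1, hxy, hx.2, fun b hb hvb => ((h1 b).1 ⟨hb, hvb⟩).symm⟩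

/-- A colouring of `A \ {u, v}`, for adjacent vertices `u`, `v` of degree two, extends to `A` if
the weight of `u` has been reserved at its other neighbour. -/
lemma IsIOColoring.extend_pair {f : V → Option ℕ} (hu : u ∈ A) (hv : v ∈ A) (huv : G.Adj u v)
    (hxA : x ∈ A) (hxv : x ≠ v) (hux : G.Adj u x) (hu' : ∀ b ∈ A, G.Adj u b → b = v ∨ b = x)
    (hzu : z ≠ u) (hvz : G.Adj v z) (hv' : ∀ b ∈ A, G.Adj v b → b = u ∨ b = z)
    (hk : w u + w v ≤ k)
    (hf : G.IsIOColoring k (Function.update w x (w x + w u)) (A \ {u, v}) f) :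
    ∃ g, G.IsIOColoring k w A g := by
  have hf' : G.IsIOColoring k w (A \ {u, v}) f := hf.mono_weight fun a => by
    by_cases h : a = x
    · subst h; simp
    · simp [h]
  have hA : A \ {u, v} ∪ {u, v} = A := sdiff_union_of_subset (by simp [insert_subset_iff, hu, hv])
  have hd : Disjoint (A \ {u, v}) {u, v} := sdiff_disjoint
  have hne := huv.ne
  have nb_u : ∀ b ∈ A \ {u, v}, G.Adj u b → b = x := by
    intro b hb hub
    simp only [mem_sdiff, mem_insert, mem_singleton, not_or] at hb
    exact (hu' b hb.1 hub).resolve_left hb.2.2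
  have nb_v : ∀ b ∈ A \ {u, v}, G.Adj v b → b = z := by
    intro b hb hub
    simp only [mem_sdiff, mem_insert, mem_singleton, not_or] at hb
    exact (hv' b hb.1 hub).resolve_left hb.2.1
  have key : ∀ P : Finset V, P ⊆ {u, v} → (u ∈ P → f x = none) → (v ∈ P → f z = none) →
      (u ∉ P → f x ≠ none) → (v ∉ P → f z ≠ none) → (u ∈ P ∨ v ∈ P) →
      ∃ g, G.IsIOColoring k w A g := by
    intro P hP h1 h2 h3 h4 h5
    rw [← hA]
    refine hf'.extend hd hP ?_ ?_ ?_ ?_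
    · simp only [mem_insert, mem_singleton]
      rintro a (rfl | rfl) ha b (rfl | rfl) hb
      · exact G.irrefl
      · tauto
      · tauto
      · exact G.irrefl
    · simp only [mem_insert, mem_singleton]
      rintro a (rfl | rfl) ha b hb hab
      · rw [nb_u b hb hab]; exact h3 ha
      · rw [nb_v b hb hab]; exact h4 ha
    · intro a ha b hb hab
      have := hP ha
      simp only [mem_insert, mem_singleton] at this
      rcases this with rfl | rfl
      · rw [nb_u b hb hab]; exact h1 ha
      · rw [nb_v b hb hab]; exact h2 ha
    · refine (sum_le_sum_of_subset hP).trans ?_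
      rw [sum_pair hne]
      exact hk
  by_cases hfx : f x = none
  · by_cases hfz : f z = none
    · exact key {u, v} subset_rfl (fun _ => hfx) (fun _ => hfz) (by simp) (by simp) (by simp)
    · exact key {u} (by simp) (fun _ => hfx) (fun h => absurd (mem_singleton.1 h) hne.symm)
        (by simp) (fun _ => hfz) (by simp)
  · by_cases hfz : f z = none
    · exact key {v} (by simp) (fun h => absurd (mem_singleton.1 h) hne) (fun _ => hfz)
        (fun _ => hfx) (by simp) (by simp)
    -- Both outer neighbours lie in `O`: `u` joins the part of `x`, where room was reserved, and `v`
    -- becomes independent.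
    obtain ⟨j, hj⟩ := Option.ne_none_iff_exists'.1 hfx
    have hxu : x ≠ u := hux.ne'
    have hx' : x ∈ A \ {u, v} := by simp [hxA, hxu, hxv]
    have hzv : z ≠ v := hvz.ne'
    set g : V → Option ℕ := fun a => if a = u then some j else if a = v then none else f a with hg
    have gu : g u = some j := by simp [hg]
    have gv : g v = none := by simp [hg, hne.symm]
    have gA : ∀ a ∈ A \ {u, v}, g a = f a := by
      intro a ha
      simp only [mem_sdiff, mem_insert, mem_singleton, not_or] at ha
      simp [hg, ha]
    have cases : ∀ a ∈ A, a = u ∨ a = v ∨ a ∈ A \ {u, v} := by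
      intro a ha
      simp only [mem_sdiff, mem_insert, mem_singleton, not_or]
      tauto
    refine ⟨g, ?_, ?_, ?_⟩
    · intro a ha b hb hab h
      rcases cases a ha with rfl | rfl | ha
      · simp [gu] at h
      · rcases cases b hb with rfl | rfl | hb
        · simp [gu]
        · exact absurd hab G.irrefl
        · rw [gA b hb, nb_v b hb hab]; exact hfz
      · rw [gA a ha] at h
        rcases cases b hb with rfl | rfl | hb
        · simp [gu]
        · rw [nb_v a ha hab.symm] at h
          exact absurd h hfz
        · rw [gA b hb]; exact hf.indep a ha b hb hab h
    · intro a ha b hb hab h h'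
      rcases cases a ha with rfl | rfl | ha
      · rcases cases b hb with rfl | rfl | hb
        · rfl
        · exact absurd gv h'
        · rw [gu, gA b hb, nb_u b hb hab, hj]
      · exact absurd gv h
      · rcases cases b hb with rfl | rfl | hb
        · rw [gu, gA a ha, nb_u a ha hab.symm, hj]
        · exact absurd gv h'
        · rw [gA a ha] at h ⊢
          rw [gA b hb] at h' ⊢
          exact hf.label a ha b hb hab h h'
    · intro i
      by_cases hij : i = j
      · subst hij
        refine le_trans ?_ (hf.weight i)
        have hx2 : x ∈ {a ∈ A \ {u, v} | f a = some i} := by simp [hx', hj]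
        have hsub : {a ∈ A | g a = some i} ⊆ insert u {a ∈ A \ {u, v} | f a = some i} := by
          intro a ha
          rw [mem_filter] at ha
          rw [mem_insert, mem_filter]
          rcases cases a ha.1 with rfl | rfl | h
          · exact .inl rfl
          · simp [gv] at ha
          · exact .inr ⟨h, (gA a h).symm.trans ha.2⟩
        refine (sum_le_sum_of_subset hsub).trans ?_
        rw [sum_insert (by simp), sum_update_of_mem hx2,
          ← add_sum_erase _ _ hx2, sdiff_singleton_eq_erase]
        omega
      · refine le_trans (sum_le_sum_of_subset ?_) (hf'.weight i)
        intro a ha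
        rw [mem_filter] at ha ⊢
        rcases cases a ha.1 with rfl | rfl | h
        · have := gu.symm.trans ha.2
          simp only [Option.some.injEq] at this
          exact absurd this.symm hij
        · simp [gv] at ha
        · exact ⟨h, (gA a h).symm.trans ha.2⟩

lemma degIn_pos (hx : x ∈ S) (h : G.Adj v x) : 1 ≤ G.degIn S v :=
  card_pos.2 ⟨x, by simp [hx, h]⟩

lemma potential_update (hx : x ∈ S) (n : ℕ) :
    G.potential k (Function.update w x (w x + n)) S = G.potential k w S - (k + 3) * n := by
  unfold potential
  have h : ∀ v ∈ S, (8 * (k : ℤ) - (k + 3) * ((Function.update w x (w x + n) v : ℤ) - 1)) =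
      (8 * (k : ℤ) - (k + 3) * ((w v : ℤ) - 1)) - if v = x then (k + 3) * (n : ℤ) else 0 := by
    intro v _
    split_ifs with h
    · subst h
      simp
      ring
    · simp [h]
  rw [sum_congr rfl h, sum_sub_distrib, sum_ite_eq' S x, if_pos hx]
  ring

lemma potential_update_of_notMem (hx : x ∉ S) (n : ℕ) :
    G.potential k (Function.update w x n) S = G.potential k w S := by
  unfold potential
  congr 1
  refine sum_congr rfl fun v hv => ?_
  rw [Function.update_of_ne]
  rintro rfl
  exact hx hv

/-! ### Structure of a minimal uncolourable set. -/

section Critical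

variable (hcol : ∀ B, B ⊂ A → ∃ f, G.IsIOColoring k w B f)
  (hA : ¬ ∃ f, G.IsIOColoring k w A f)

include hcol hA

lemma degIn_ne_zero_of_critical (hv : v ∈ A) : G.degIn A v ≠ 0 := by
  intro h
  have h0 : ∀ b ∈ A, ¬ G.Adj v b := by simpa [degIn, filter_eq_empty_iff] using h
  obtain ⟨f, hf⟩ := hcol _ (erase_ssubset hv)
  apply hA
  have := hf.extend (N := {v}) (P := ∅) (by simp) (by simp) (by simp)
    (by simpa using fun b _ hb hvb => absurd hvb (h0 b hb)) (by simp) (by simp)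
  rwa [union_comm, ← insert_eq, insert_erase hv] at this

lemma lt_weight_of_degIn_eq_one (hv : v ∈ A) (h : G.degIn A v = 1) : k < w v := by
  by_contra! hk
  obtain ⟨x, hx, hvx, hx'⟩ := exists_unique_neighbor_of_degIn_eq_one h
  obtain ⟨f, hf⟩ := hcol _ (erase_ssubset hv)
  apply hA
  have key : ∀ P : Finset V, P ⊆ {v} → (v ∈ P → f x = none) → (v ∉ P → f x ≠ none) →
      ∃ f, G.IsIOColoring k w A f := by
    intro P hP h1 h2
    have := hf.extend (N := {v}) (P := P) (by simp) hP (by simp) ?_ ?_ ?_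
    · rwa [union_comm, ← insert_eq, insert_erase hv] at this
    · simp only [mem_singleton]
      rintro a rfl ha b hb hab
      rw [hx' b (mem_of_mem_erase hb) hab]
      exact h2 ha
    · intro a ha b hb hab
      obtain rfl := mem_singleton.1 (hP ha)
      rw [hx' b (mem_of_mem_erase hb) hab]
      exact h1 ha
    · exact (sum_le_sum_of_subset hP).trans (by simpa using hk)
  by_cases hfx : f x = none
  · exact key {v} subset_rfl (fun _ => hfx) (by simp)
  · exact key ∅ (by simp) (by simp) (fun _ => hfx)

/-- The weight of a set of vertices together with its neighbours of degree two exceeds `k`, if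
it has no other neighbours. -/
lemma lt_weight_of_critical
    (hpair : ∀ u ∈ A, ∀ v ∈ A, G.Adj u v → G.degIn A u = 2 → G.degIn A v = 2 → k < w u + w v)
    (hQA : Q ⊆ A) (hQ : Q.Nonempty)
    (hnb : ∀ a ∈ Q, ∀ b ∈ A, G.Adj a b → b ∉ Q → G.degIn A b = 2) :
    k < ∑ a ∈ Q, w a + ∑ b ∈ {b ∈ A | b ∉ Q ∧ ∃ a ∈ Q, G.Adj a b}, w b := by
  by_contra! hk
  set Y := {b ∈ A | b ∉ Q ∧ ∃ a ∈ Q, G.Adj a b} with hY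
  have hYA : Y ⊆ A := filter_subset _ _
  have hd : Disjoint Q Y := Finset.disjoint_left.2 fun a ha hb => (mem_filter.1 hb).2.1 ha
  rw [← sum_union hd] at hk
  have hNA : Q ∪ Y ⊆ A := union_subset hQA hYA
  have hss : A \ (Q ∪ Y) ⊂ A := sdiff_ssubset hNA (hQ.mono subset_union_left)
  obtain ⟨f, hf⟩ := hcol _ hss
  apply hA
  have hdeg : ∀ b ∈ Y, G.degIn A b = 2 := by
    intro b hb
    obtain ⟨hbA, hbQ, a, ha, hab⟩ := mem_filter.1 hb
    exact hnb a ha b hbA hab hbQ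
  -- A vertex of `Y` goes to `I` only if it has an outer neighbour in `O`. Its other neighbour lies
  -- in `Q`, so it has no further neighbour.
  have := hf.extend (N := Q ∪ Y)
    (P := Q ∪ {y ∈ Y | ∀ b ∈ A \ (Q ∪ Y), G.Adj y b → f b = none}) sdiff_disjoint
    (union_subset_union_right (filter_subset _ _)) ?_ ?_ ?_ ?_
  · rwa [sdiff_union_of_subset hNA] at this
  · intro a ha ha' b hb hb' hab
    have haY : a ∈ Y := by
      simp only [mem_union] at ha ha'
      tauto
    have hbY : b ∈ Y := by
      simp only [mem_union] at hb hb'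
      tauto
    -- Adjacent vertices of `Y` would alone weigh more than `k`.
    have h1 := hpair a (hYA haY) b (hYA hbY) hab (hdeg a haY) (hdeg b hbY)
    have h2 : ∑ v ∈ {a, b}, w v ≤ ∑ v ∈ Q ∪ Y, w v :=
      sum_le_sum_of_subset (by
        simp only [insert_subset_iff, singleton_subset_iff]
        exact ⟨ha, hb⟩)
    rw [sum_pair hab.ne] at h2
    omega
  · intro a ha ha' b hb hab
    simp only [mem_union, mem_filter, not_or, not_and] at ha ha'
    have haY : a ∈ Y := ha.resolve_left ha'.1
    have h3 := ha'.2 haY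
    push Not at h3
    obtain ⟨c, hc, hac, hfc⟩ := h3
    obtain ⟨haA, -, q, hq, hqa⟩ := mem_filter.1 haY
    obtain ⟨x, -, -, -, hx⟩ := exists_other_neighbor_of_degIn_eq_two (hdeg a haY) (hQA hq) hqa.symm
    have hout : ∀ b ∈ A \ (Q ∪ Y), G.Adj a b → b = x := by
      intro b hb hab
      rw [mem_sdiff, mem_union, not_or] at hb
      refine (hx b hb.1 hab).resolve_left ?_
      rintro rfl
      exact hb.2.1 hq
    rwa [hout b hb hab, ← hout c hc hac]
  · intro a ha b hb hab
    rcases mem_union.1 ha with ha | ha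
    · rw [mem_sdiff, mem_union, not_or] at hb
      exact absurd (mem_filter.2 ⟨hb.1, hb.2.1, a, ha, hab⟩) hb.2.2
    · exact (mem_filter.1 ha).2 b hb hab
  · exact (sum_le_sum_of_subset (union_subset_union_right (filter_subset _ _))).trans hk

end Critical

/-- If the colouring of `A \ {u, v}` with the weight of `u` reserved at `x` does not exist, then
`x` lies in a set of small potential. -/
lemma exists_potential_le_of_pair
    (hmin : ∀ B, B ⊂ A → ∀ w' : V → ℕ, (∀ v, 1 ≤ w' v) →
      (∀ S ⊆ B, S.Nonempty → 0 < G.potential k w' S) → ∃ f, G.IsIOColoring k w' B f)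
    (hA : ¬ ∃ f, G.IsIOColoring k w A f) (hw : ∀ v, 1 ≤ w v)
    (hpot : ∀ S ⊆ A, S.Nonempty → 0 < G.potential k w S)
    (hu : u ∈ A) (hv : v ∈ A) (huv : G.Adj u v)
    (hxA : x ∈ A) (hxv : x ≠ v) (hux : G.Adj u x) (hu' : ∀ b ∈ A, G.Adj u b → b = v ∨ b = x)
    (hzu : z ≠ u) (hvz : G.Adj v z) (hv' : ∀ b ∈ A, G.Adj v b → b = u ∨ b = z)
    (hk : w u + w v ≤ k) :
    ∃ S ⊆ A \ {u, v}, x ∈ S ∧ G.potential k w S ≤ (k + 3) * w u := by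
  by_contra! hS
  have hss : A \ {u, v} ⊂ A :=
    sdiff_ssubset (by simp [insert_subset_iff, hu, hv]) (insert_nonempty _ _)
  obtain ⟨f, hf⟩ := hmin _ hss (Function.update w x (w x + w u))
    (fun a => by
      by_cases h : a = x
      · subst h
        simpa using (hw a).trans (Nat.le_add_right _ _)
      · simpa [h] using hw a)
    (fun S hSA hne => by
      by_cases hx : x ∈ S
      · rw [potential_update hx]
        have := hS S hSA hx
        linarith
      · rw [potential_update_of_notMem hx]
        exact hpot S (hSA.trans sdiff_subset) hne)
  exact hA (hf.extend_pair hu hv huv hxA hxv hux hu' hzu hvz hv' hk)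

/-- Otherwise reserving weight fails at both outer neighbours, giving low-potential sets `S` and
`T`. By submodularity `S ∪ T` has potential at most `(k + 3) * (w u + w v)`. Adding `u` and `v`
brings at least three edges and, since `16k + 2(k + 3) = 6(3k + 1)`, lowers the potential by at
least that amount. -/
lemma lt_weight_add_weight_of_critical
    (hmin : ∀ B, B ⊂ A → ∀ w' : V → ℕ, (∀ v, 1 ≤ w' v) →
      (∀ S ⊆ B, S.Nonempty → 0 < G.potential k w' S) → ∃ f, G.IsIOColoring k w' B f)
    (hA : ¬ ∃ f, G.IsIOColoring k w A f) (hw : ∀ v, 1 ≤ w v)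
    (hpot : ∀ S ⊆ A, S.Nonempty → 0 < G.potential k w S)
    (hu : u ∈ A) (hv : v ∈ A) (huv : G.Adj u v)
    (hdu : G.degIn A u = 2) (hdv : G.degIn A v = 2) : k < w u + w v := by
  by_contra! hk
  obtain ⟨x, hxA, hxv, hux, hu'⟩ := exists_other_neighbor_of_degIn_eq_two hdu hv huv
  obtain ⟨z, hzA, hzu, hvz, hv'⟩ := exists_other_neighbor_of_degIn_eq_two hdv hu huv.symm
  obtain ⟨S, hSA, hxS, hS⟩ := exists_potential_le_of_pair hmin hA hw hpot hu hv huv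
    hxA hxv hux hu' hzu hvz hv' hk
  obtain ⟨T, hTA, hzT, hT⟩ := exists_potential_le_of_pair hmin hA hw hpot hv hu huv.symm
    hzA hzu hvz hv' hxv hux hu' (by omega)
  rw [pair_comm] at hTA
  have hsub := potential_submodular G k w S T
  have hinter : 0 ≤ G.potential k w (S ∩ T) := by
    rcases (S ∩ T).eq_empty_or_nonempty with h | h
    · simp [h, potential, adjPairs]
    · exact (hpot _ (inter_subset_left.trans (hSA.trans sdiff_subset)) h).le
  have hST : S ∪ T ⊆ A \ {u, v} := union_subset hSA hTA
  have huT : u ∉ S ∪ T := fun h => by simpa using hST h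
  have hvT : v ∉ insert u (S ∪ T) := by
    rw [mem_insert, not_or]
    exact ⟨huv.ne', fun h => by simpa using hST h⟩
  have h1 : 1 ≤ G.degIn (S ∪ T) u := degIn_pos (mem_union_left _ hxS) hux
  have h2 : 2 ≤ G.degIn (insert u (S ∪ T)) v := by
    rw [degIn, ← card_pair hzu]
    refine card_le_card ?_
    simp [insert_subset_iff, hvz, huv.symm, hzT]
  have hpos := hpot (insert v (insert u (S ∪ T)))
    (insert_subset hv (insert_subset hu (hST.trans sdiff_subset))) (insert_nonempty _ _)
  rw [potential_insert hvT, potential_insert huT] at hpos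
  have h1' : (1 : ℤ) ≤ G.degIn (S ∪ T) u := by exact_mod_cast h1
  have h2' : (2 : ℤ) ≤ G.degIn (insert u (S ∪ T)) v := by exact_mod_cast h2
  nlinarith [mul_le_mul_of_nonneg_left h1' (by positivity : (0 : ℤ) ≤ 2 * (3 * k + 1)),
    mul_le_mul_of_nonneg_left h2' (by positivity : (0 : ℤ) ≤ 2 * (3 * k + 1))]

/-! ### Discharging. -/

lemma two_mul_card_le_adjPairs_add_two (h : (G.induce (Q : Set V)).Connected) :
    2 * #Q ≤ G.adjPairs Q + 2 := by
  have h1 := h.card_vert_le_card_edgeSet_add_one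
  have h2 := (G.induce (Q : Set V)).sum_degrees_eq_twice_card_edges
  have h3 : ∀ a : (Q : Set V), (G.induce (Q : Set V)).degree a = G.degIn Q a := by
    intro a
    rw [← card_neighborFinset_eq_degree, degIn, ← card_map (Function.Embedding.subtype _)]
    congr 1
    ext b
    simp only [mem_map, mem_neighborFinset, comap_adj, mem_filter]
    constructor
    · rintro ⟨c, hc, rfl⟩
      exact ⟨c.2, hc⟩
    · rintro ⟨hb, hab⟩
      exact ⟨⟨b, hb⟩, hab, rfl⟩
  simp only [h3] at h2
  have h4 : ∑ a : (Q : Set V), G.degIn Q a = G.adjPairs Q := by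
    rw [adjPairs_eq_sum]
    exact sum_coe_sort Q (fun a => G.degIn Q a)
  rw [h4] at h2
  rw [Nat.card_eq_fintype_card, Nat.card_eq_fintype_card, ← edgeFinset_card] at h1
  have h5 : Fintype.card (Q : Set V) = #Q := by simp
  omega

/-- A sum over `T` is nonnegative if it is so over each component of `G[T]`. -/
lemma sum_nonneg_of_components (g : V → ℤ)
    (h : ∀ Q ⊆ T, (G.induce (Q : Set V)).Connected →
      (∀ a ∈ Q, ∀ b ∈ T, G.Adj a b → b ∈ Q) → 0 ≤ ∑ a ∈ Q, g a) :
    0 ≤ ∑ a ∈ T, g a := by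
  -- Keeping `V` as vertex type makes the vertices outside `T` isolated, so a component meeting `T`
  -- lies in `T`.
  set H : SimpleGraph V := (G.induce (T : Set V)).spanningCoe with hH
  have hadj : ∀ a b, H.Adj a b ↔ a ∈ T ∧ b ∈ T ∧ G.Adj a b := by
    intro a b
    simp only [hH, map_adj, comap_adj]
    constructor
    · rintro ⟨c, d, hcd, rfl, rfl⟩
      exact ⟨c.2, d.2, hcd⟩
    · rintro ⟨ha, hb, hab⟩
      exact ⟨⟨a, ha⟩, ⟨b, hb⟩, hab, rfl, rfl⟩
  have hreach : ∀ a b, H.Reachable a b → b ∈ T → a ∈ T := by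
    rintro a b ⟨p⟩ hb
    induction p with
    | nil => exact hb
    | cons hab _ _ => exact ((hadj _ _).1 hab).1
  rw [← sum_fiberwise_of_maps_to (t := T.image H.connectedComponentMk)
    (g := H.connectedComponentMk) (fun a ha => mem_image_of_mem _ ha)]
  refine sum_nonneg fun c hc => ?_
  obtain ⟨v, hv, rfl⟩ := mem_image.1 hc
  have hsupp : (({a ∈ T | H.connectedComponentMk a = H.connectedComponentMk v} : Finset V) :
      Set V) = (H.connectedComponentMk v).supp := by
    ext a
    simp only [coe_filter, Set.mem_ofPred_eq, ConnectedComponent.mem_supp_iff, and_iff_right_iff_imp]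
    exact fun ha => hreach a v (ConnectedComponent.exact ha) hv
  refine h _ (filter_subset _ _) ?_ ?_
  · rw [hsupp]
    refine (ConnectedComponent.connected_toSimpleGraph _).mono ?_
    intro a b hab
    exact ((hadj _ _).1 hab).2.2
  · intro a ha b hb hab
    rw [mem_filter] at ha ⊢
    refine ⟨hb, ?_⟩
    rw [← ha.2]
    exact ConnectedComponent.sound ((hadj _ _).2 ⟨hb, ha.1, hab.symm⟩).reachable

/-- The discharging rule: the charge that a vertex of degree `da` and weight `wa` sends to a
neighbour of degree `db` and weight `wb`. -/
def transfer (k : ℤ) (da db : ℕ) (wa wb : ℤ) : ℤ :=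
  if da = 2 then
    if db = 2 then (k + 3) * (wa - wb)
    else if db = 3 then 2 * ((k + 3) * wa - (3 * k + 1)) else -(4 * (k - 1))
  else if da = 3 then
    if db = 2 then 2 * ((3 * k + 1) - (k + 3) * wb)
    else if db = 3 then 0 else -(4 * (k - 1))
  else if db = 2 ∨ db = 3 then 4 * (k - 1) else 0

lemma transfer_antisymm (k : ℤ) (da db : ℕ) (wa wb : ℤ) :
    transfer k da db wa wb = -transfer k db da wb wa := by
  by_cases h1 : da = 2 <;> by_cases h2 : da = 3 <;> by_cases h3 : db = 2 <;>
    by_cases h4 : db = 3 <;> simp [transfer, h1, h2, h3, h4] <;> first | omega | ring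

lemma sum_transfer_eq_zero (G : SimpleGraph V) (k : ℤ) (w : V → ℕ) (d : V → ℕ) (A : Finset V) :
    ∑ a ∈ A, ∑ b ∈ A with G.Adj a b, transfer k (d a) (d b) (w a) (w b) = 0 := by
  have h : ∑ a ∈ A, ∑ b ∈ A with G.Adj a b, transfer k (d a) (d b) (w a) (w b) =
      -∑ a ∈ A, ∑ b ∈ A with G.Adj a b, transfer k (d a) (d b) (w a) (w b) := by
    simp only [sum_filter]
    conv_lhs => rw [sum_comm]
    simp only [← sum_neg_distrib]
    refine sum_congr rfl fun a _ => sum_congr rfl fun b _ => ?_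
    rw [G.adj_comm]
    split_ifs
    · exact transfer_antisymm _ _ _ _ _
    · simp
  omega

/-- The final charge of a component of the graph of vertices of degree three. -/
lemma component_charge_nonneg {k q O t M β : ℕ} (hk : 2 ≤ k) (hq : 1 ≤ q) (hO : q ≤ O)
    (ht : t + β ≤ q + 2) (hM : t ≤ M) (hW : β = 0 → k + 1 ≤ O + M) :
    (0 : ℤ) ≤ 2 * (k + 3) * O - (3 * k + 1) * t + (k + 3) * M + 2 * (k - 1) * β := by
  have hβ := Int.natCast_nonneg β
  zify at *
  generalize (k : ℤ) = k at *
  generalize (q : ℤ) = q at *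
  generalize (O : ℤ) = O at *
  generalize (t : ℤ) = t at *
  generalize (M : ℤ) = M at *
  generalize (β : ℤ) = β at *
  have h1 : (k + 3) * t ≤ (k + 3) * M := by gcongr
  by_cases hb : β = 0
  · have hW := hW hb
    subst hb
    by_cases h : 2 * O ≤ k - 1
    -- Using `M ≥ k + 1 - O` and `t ≤ O + 2`, the charge is at least `(k - 1)(k - 1 - 2O)`.
    · nlinarith [mul_nonneg (by linarith : 0 ≤ k - 1) (by linarith : 0 ≤ k - 1 - 2 * O),
        mul_le_mul_of_nonneg_left (by linarith : k + 1 - O ≤ M) (by linarith : 0 ≤ k + 3),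
        mul_le_mul_of_nonneg_left (by linarith : t ≤ O + 2) (by linarith : 0 ≤ 3 * k + 1)]
    -- Using `M ≥ t` instead, it is at least `4(2O - k + 1)`.
    · nlinarith [mul_le_mul_of_nonneg_left (by linarith : t ≤ O + 2) (by linarith : 0 ≤ k - 1)]
  · have hb1 : 1 ≤ β := by omega
    nlinarith [mul_le_mul_of_nonneg_left (by linarith : t ≤ O + 2 - β) (by linarith : 0 ≤ k - 1),
      mul_le_mul_of_nonneg_left hb1 (by linarith : 0 ≤ k - 1)]

/-- Four times the charge of `a` after discharging. -/
noncomputable def finalCharge (G : SimpleGraph V) (k : ℕ) (w : V → ℕ) (A : Finset V) (a : V) : ℤ :=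
  4 * ((3 * k + 1) * G.degIn A a - 8 * k + (k + 3) * ((w a : ℤ) - 1)) -
    ∑ b ∈ A with G.Adj a b, transfer k (G.degIn A a) (G.degIn A b) (w a) (w b)

lemma sum_biUnion_le_sum_sum (Q : Finset V) (t : V → Finset V) (w : V → ℕ) :
    ∑ b ∈ Q.biUnion t, w b ≤ ∑ a ∈ Q, ∑ b ∈ t a, w b := by
  induction Q using Finset.induction_on with
  | empty => simp
  | insert a Q ha ih =>
    rw [biUnion_insert, sum_insert ha]
    have := sum_union_inter (s₁ := t a) (s₂ := Q.biUnion t) (f := w)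
    omega

/-- Connectedness gives at least `#Q - 1` inner edges, so at most `#Q + 2` edges leave `Q`. Without
neighbours of degree other than two and three, `h3` makes `Q` and its neighbours heavy; otherwise
the charge received from such a neighbour suffices. -/
lemma sum_finalCharge_component_nonneg (hk : 2 ≤ k) (hw : ∀ v, 1 ≤ w v)
    (h3 : ∀ Q ⊆ A, Q.Nonempty →
      (∀ a ∈ Q, ∀ b ∈ A, G.Adj a b → b ∉ Q → G.degIn A b = 2) →
      k < ∑ a ∈ Q, w a + ∑ b ∈ {b ∈ A | b ∉ Q ∧ ∃ a ∈ Q, G.Adj a b}, w b)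
    (hQ : Q ⊆ {a ∈ A | G.degIn A a = 3}) (hconn : (G.induce (Q : Set V)).Connected)
    (hclosed : ∀ a ∈ Q, ∀ b ∈ {a ∈ A | G.degIn A a = 3}, G.Adj a b → b ∈ Q) :
    0 ≤ ∑ a ∈ Q, G.finalCharge k w A a := by
  set d := G.degIn A with hd
  have hQA : Q ⊆ A := hQ.trans (filter_subset _ _)
  have hd3 : ∀ a ∈ Q, d a = 3 := fun a ha => (mem_filter.1 (hQ ha)).2
  have hne : Q.Nonempty := by
    obtain ⟨a⟩ := hconn.nonempty
    exact ⟨a, a.2⟩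
  set n2 : V → ℕ := fun a => #{b ∈ A | G.Adj a b ∧ d b = 2} with hn2
  set nO : V → ℕ := fun a => #{b ∈ A | G.Adj a b ∧ d b ≠ 2 ∧ d b ≠ 3} with hnO
  set m : V → ℕ := fun a => ∑ b ∈ A with G.Adj a b ∧ d b = 2, w b with hm
  have hdeg : ∀ a ∈ Q, G.degIn Q a + n2 a + nO a = 3 := by
    intro a ha
    rw [← hd3 a ha]
    have e : ∀ b ∈ A, ((if G.Adj a b then 1 else 0 : ℕ)) =
        (if G.Adj a b ∧ d b = 3 then 1 else 0) + (if G.Adj a b ∧ d b = 2 then 1 else 0) +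
        (if G.Adj a b ∧ d b ≠ 2 ∧ d b ≠ 3 then 1 else 0) := by
      intro b _
      by_cases hab : G.Adj a b <;> by_cases hb2 : d b = 2 <;> by_cases hb3 : d b = 3 <;>
        simp [hab, hb2, hb3]
    have e3 : G.degIn Q a = #{b ∈ A | G.Adj a b ∧ d b = 3} := by
      unfold degIn
      congr 1
      ext b
      simp only [mem_filter]
      constructor
      · rintro ⟨hb, hab⟩
        exact ⟨hQA hb, hab, hd3 b hb⟩
      · rintro ⟨hb, hab, hb3⟩
        exact ⟨hclosed a ha b (mem_filter.2 ⟨hb, hb3⟩) hab, hab⟩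
    have e4 : d a = ∑ b ∈ A, if G.Adj a b then 1 else 0 := by
      rw [hd, degIn, card_filter]
    rw [e3, e4, sum_congr rfl e, sum_add_distrib, sum_add_distrib, hn2, hnO]
    simp only [card_filter]
  have hfinQ : ∀ a ∈ Q, G.finalCharge k w A a = 4 * (k + 3) * (w a : ℤ) - 2 * (3 * k + 1) * n2 a
      + 2 * (k + 3) * m a + 4 * (k - 1) * nO a := by
    intro a ha
    have e : ∀ b ∈ A, (if G.Adj a b then transfer k 3 (d b) (w a) (w b) else 0) =
        2 * (3 * k + 1) * (if G.Adj a b ∧ d b = 2 then 1 else 0) -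
        2 * (k + 3) * (if G.Adj a b ∧ d b = 2 then (w b : ℤ) else 0) -
        4 * (k - 1) * (if G.Adj a b ∧ d b ≠ 2 ∧ d b ≠ 3 then 1 else 0) := by
      intro b _
      by_cases hab : G.Adj a b <;> by_cases hb2 : d b = 2 <;> by_cases hb3 : d b = 3 <;>
        simp [transfer, hab, hb2, hb3] <;> first | omega | ring
    simp only [finalCharge, ← hd, hn2, hnO, hm, hd3 a ha]
    rw [sum_filter, sum_congr rfl e, sum_sub_distrib, sum_sub_distrib, ← mul_sum, ← mul_sum,
      ← mul_sum, card_filter, card_filter, sum_filter]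
    push_cast
    ring
  rw [sum_congr rfl hfinQ, sum_add_distrib, sum_add_distrib, sum_sub_distrib, ← mul_sum,
    ← mul_sum, ← mul_sum, ← mul_sum]
  simp only [← Nat.cast_sum]
  have hpairs := two_mul_card_le_adjPairs_add_two hconn
  have hsum : G.adjPairs Q + ∑ a ∈ Q, n2 a + ∑ a ∈ Q, nO a = 3 * #Q := by
    rw [adjPairs_eq_sum, ← sum_add_distrib, ← sum_add_distrib, sum_congr rfl hdeg]
    simp [mul_comm]
  have hO : #Q ≤ ∑ a ∈ Q, w a := by
    simpa using sum_le_sum fun a (_ : a ∈ Q) => hw a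
  have hM : ∑ a ∈ Q, n2 a ≤ ∑ a ∈ Q, m a := by
    refine sum_le_sum fun a _ => ?_
    simp only [hn2, hm, card_eq_sum_ones]
    exact sum_le_sum fun b _ => hw b
  have hW : ∑ a ∈ Q, nO a = 0 → k + 1 ≤ ∑ a ∈ Q, w a + ∑ a ∈ Q, m a := by
    intro hz
    have hz' : ∀ a ∈ Q, ∀ b ∈ A, G.Adj a b → d b = 2 ∨ d b = 3 := by
      intro a ha b hb hab
      have := (sum_eq_zero_iff.1 hz) a ha
      rw [hnO, card_eq_zero, filter_eq_empty_iff] at this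
      have := this hb
      tauto
    have hnb : ∀ a ∈ Q, ∀ b ∈ A, G.Adj a b → b ∉ Q → d b = 2 := by
      intro a ha b hb hab hbQ
      refine (hz' a ha b hb hab).resolve_right fun h => ?_
      exact hbQ (hclosed a ha b (mem_filter.2 ⟨hb, h⟩) hab)
    refine (h3 Q hQA hne hnb).trans_le (Nat.add_le_add_left ?_ _)
    -- A degree-two vertex with two neighbours in `Q` is counted twice in the sum of `m`, which only
    -- helps.
    have hsub : {b ∈ A | b ∉ Q ∧ ∃ a ∈ Q, G.Adj a b} ⊆
        Q.biUnion fun a => {b ∈ A | G.Adj a b ∧ d b = 2} := by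
      intro b hb
      obtain ⟨hbA, hbQ, a, ha, hab⟩ := mem_filter.1 hb
      exact mem_biUnion.2 ⟨a, ha, mem_filter.2 ⟨hbA, hab, hnb a ha b hbA hab hbQ⟩⟩
    refine (sum_le_sum_of_subset hsub).trans ?_
    exact sum_biUnion_le_sum_sum _ _ _
  have hcard := hne.card_pos
  have := component_charge_nonneg hk hcard hO (by omega) hM hW
  linarith

lemma potential_nonpos_of_discharging (hk : 2 ≤ k) (hw : ∀ v, 1 ≤ w v)
    (h0 : ∀ v ∈ A, G.degIn A v ≠ 0) (h1 : ∀ v ∈ A, G.degIn A v = 1 → k < w v)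
    (h2 : ∀ u ∈ A, ∀ v ∈ A, G.Adj u v → G.degIn A u = 2 → G.degIn A v = 2 → k < w u + w v)
    (h3 : ∀ Q ⊆ A, Q.Nonempty →
      (∀ a ∈ Q, ∀ b ∈ A, G.Adj a b → b ∉ Q → G.degIn A b = 2) →
      k < ∑ a ∈ Q, w a + ∑ b ∈ {b ∈ A | b ∉ Q ∧ ∃ a ∈ Q, G.Adj a b}, w b) :
    G.potential k w A ≤ 0 := by
  have hk' : (2 : ℤ) ≤ k := by exact_mod_cast hk
  have hw' : ∀ v, (1 : ℤ) ≤ w v := fun v => by exact_mod_cast hw v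
  set d := G.degIn A with hd
  set τ : V → V → ℤ := fun a b => transfer k (d a) (d b) (w a) (w b) with hτ
  set ch : V → ℤ := fun a => 4 * ((3 * k + 1) * d a - 8 * k + (k + 3) * ((w a : ℤ) - 1)) with hch
  have hfin : G.finalCharge k w A = fun a => ch a - ∑ b ∈ A with G.Adj a b, τ a b := rfl
  have htotal : ∑ a ∈ A, G.finalCharge k w A a = -4 * G.potential k w A := by
    have e1 : ∑ a ∈ A, G.finalCharge k w A a = ∑ a ∈ A, ch a := by
      rw [hfin, sum_sub_distrib, sum_transfer_eq_zero G k w d A, sub_zero]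
    rw [e1, potential, adjPairs_eq_sum]
    push_cast
    rw [mul_sum, ← sum_sub_distrib, mul_sum]
    refine sum_congr rfl fun a _ => ?_
    simp only [hch, hd]
    ring
  suffices 0 ≤ ∑ a ∈ A, G.finalCharge k w A a by linarith
  have hbound : ∀ a, ∀ c : ℤ, (∀ b ∈ A, G.Adj a b → τ a b ≤ c) →
      ∑ b ∈ A with G.Adj a b, τ a b ≤ d a * c := by
    intro a c h
    have := sum_le_card_nsmul {b ∈ A | G.Adj a b} (τ a) c
      (fun b hb => h b (mem_filter.1 hb).1 (mem_filter.1 hb).2)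
    simpa [hd, degIn] using this
  rw [← sum_filter_add_sum_filter_not A (fun a => d a = 3)]
  refine add_nonneg ?_ (sum_nonneg fun a ha => ?_)
  · refine sum_nonneg_of_components (G := G) _ fun Q hQ hconn hclosed => ?_
    exact sum_finalCharge_component_nonneg hk hw h3 hQ hconn hclosed
  · obtain ⟨haA, ha3⟩ := mem_filter.1 ha
    by_cases ha2 : d a = 2
    -- Half the initial charge of a degree-two vertex, so sending at most this along each edge
    -- suffices.
    · have := hbound a (2 * ((k + 3) * w a - (3 * k + 1))) ?_
      · simp only [hfin, hch]
        rw [ha2] at this ⊢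
        push_cast at this ⊢
        linarith
      · intro b hb hab
        by_cases hb2 : d b = 2
        · have hlt : (k : ℤ) + 1 ≤ w a + w b := by exact_mod_cast h2 a haA b hb hab ha2 hb2
          simp only [hτ, transfer, ha2, hb2, if_true]
          -- The slack comes from `(k + 3)(k + 1) - 2(3k + 1) = (k - 1)²`.
          nlinarith [mul_le_mul_of_nonneg_left hlt (by linarith : (0 : ℤ) ≤ k + 3),
            sq_nonneg ((k : ℤ) - 1)]
        · by_cases hb3 : d b = 3
          · simp [hτ, transfer, ha2, hb3]
          · simp only [hτ, transfer, ha2, hb2, hb3, if_true, if_false]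
            nlinarith [mul_le_mul_of_nonneg_left (hw' a) (by linarith : (0 : ℤ) ≤ k + 3)]
    · have := hbound a (4 * (k - 1)) ?_
      · simp only [hfin, hch]
        have hwa := mul_nonneg (by linarith : (0 : ℤ) ≤ k + 3)
          (by linarith [hw' a] : (0 : ℤ) ≤ (w a : ℤ) - 1)
        by_cases ha1 : d a = 1
        · have hlt : (k : ℤ) + 1 ≤ w a := by exact_mod_cast h1 a haA ha1
          rw [ha1] at this ⊢
          push_cast at this ⊢
          -- A leaf keeps at least `4(k - 1)(k - 2)`.
          nlinarith [mul_le_mul_of_nonneg_left hlt (by linarith : (0 : ℤ) ≤ k + 3)]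
        · have ha4 : (4 : ℤ) ≤ d a := by
            have := h0 a haA
            exact_mod_cast (by omega : 4 ≤ d a)
          nlinarith [mul_le_mul_of_nonneg_left ha4 (by linarith : (0 : ℤ) ≤ k + 1)]
      · intro b _ _
        simp only [hτ, transfer, ha2, ha3, if_false]
        split_ifs <;> linarith

/-! ### The weighted theorem and its specialisation to unit weights. -/

/-- A weighted graph all of whose nonempty vertex sets have positive potential has a weighted
`(𝓘, 𝓞ₖ)`-partition. -/
theorem exists_isIOColoring (hk : 2 ≤ k) (A : Finset V) : ∀ w : V → ℕ, (∀ v, 1 ≤ w v) →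
    (∀ S ⊆ A, S.Nonempty → 0 < G.potential k w S) → ∃ f, G.IsIOColoring k w A f := by
  induction A using Finset.strongInduction with
  | H A ih =>
    -- The weight stays universally quantified in `ih`, because the pair reduction changes it.
    intro w hw hpot
    rcases A.eq_empty_or_nonempty with rfl | hne
    · exact ⟨fun _ => none, by simp, by simp, by simp⟩
    by_contra hA
    have hcol : ∀ B, B ⊂ A → ∃ f, G.IsIOColoring k w B f := fun B hB =>
      ih B hB w hw fun S hS => hpot S (hS.trans hB.subset)
    have hpair : ∀ u ∈ A, ∀ v ∈ A, G.Adj u v → G.degIn A u = 2 → G.degIn A v = 2 →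
        k < w u + w v := fun u hu v hv huv hdu hdv =>
      lt_weight_add_weight_of_critical ih hA hw hpot hu hv huv hdu hdv
    exact (hpot A subset_rfl hne).not_ge <| potential_nonpos_of_discharging hk hw
      (fun v hv => degIn_ne_zero_of_critical hcol hA hv)
      (fun v hv => lt_weight_of_degIn_eq_one hcol hA hv) hpair
      (fun Q hQ hne hnb => lt_weight_of_critical hcol hA hpair hQ hne hnb)

/-- Labels are constant on components of `G[O]`, so each component lies in one label class, of size
at most `k`. -/
lemma IsIOColoring.admitsIOPartition [Fintype V] {f : V → Option ℕ}
    (hf : G.IsIOColoring k (fun _ => 1) univ f) : G.AdmitsIOPartition k := by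
  refine ⟨{v | f v = none}, {v | f v ≠ none}, ?_, ?_, ?_, ?_⟩
  · ext v
    simp [em]
  · rw [Set.disjoint_left]
    exact fun v h h' => h' h
  · rintro ⟨a, ha⟩ ⟨b, hb⟩ hab
    exact hf.indep a (mem_univ _) b (mem_univ _) hab ha hb
  · intro c
    obtain ⟨⟨v, hv⟩, rfl⟩ := c.exists_rep
    obtain ⟨i, hi⟩ := Option.ne_none_iff_exists'.1 hv
    have hreach : ∀ a b, (G.induce {v | f v ≠ none}).Reachable a b → f a = f b := by
      rintro a b ⟨p⟩
      induction p with
      | nil => rfl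
      | cons hab _ ih => exact (hf.label _ (mem_univ _) _ (mem_univ _) hab
          (Subtype.property (p := fun v => f v ≠ none) _)
          (Subtype.property (p := fun v => f v ≠ none) _)).trans ih
    have hsub : Subtype.val '' ((G.induce {v | f v ≠ none}).connectedComponentMk ⟨v, hv⟩).supp ⊆
        (({a | f a = some i} : Finset V) : Set V) := by
      rintro _ ⟨a, ha, rfl⟩
      have := hreach _ _ (ConnectedComponent.exact ha)
      simpa [hi] using this
    refine (Subtype.val_injective.encard_image _).symm.le.trans ((Set.encard_le_encard hsub).trans ?_)
    rw [Set.encard_coe_eq_coe_finsetCard]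
    have := hf.weight i
    rw [← card_eq_sum_ones] at this
    exact_mod_cast this

lemma adjPairs_eq_two_mul_ncard [Finite V] (G : SimpleGraph V) (S : Finset V) :
    G.adjPairs S = 2 * ((⊤ : G.Subgraph).induce (S : Set V)).edgeSet.ncard := by
  cases nonempty_fintype V
  set H := ((⊤ : G.Subgraph).induce (S : Set V)).spanningCoe with hH
  have h1 := H.sum_degrees_eq_twice_card_edges
  have h2 : ((⊤ : G.Subgraph).induce (S : Set V)).edgeSet.ncard = #H.edgeFinset := by
    rw [← Set.ncard_coe_finset, coe_edgeFinset]
    rfl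
  rw [h2, ← h1, adjPairs_eq_sum, ← sum_subset (subset_univ S)]
  · refine sum_congr rfl fun a ha => ?_
    rw [← card_neighborFinset_eq_degree, degIn]
    congr 1
    ext b
    simp [hH, ha]
  · intro a _ ha
    rw [← card_neighborFinset_eq_degree, card_eq_zero]
    ext b
    simp [hH, ha]

lemma potential_pos_of_mad_lt [Finite V] (hG : G.mad < 8 * (k : ℝ) / (3 * (k : ℝ) + 1))
    (hS : S.Nonempty) : 0 < G.potential k (fun _ => 1) S := by
  have hle : 2 * (((⊤ : G.Subgraph).induce (S : Set V)).edgeSet.ncard : ℝ) / (#S : ℝ) ≤ G.mad := by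
    -- Boundedness holds because a finite graph has finitely many subgraphs.
    refine le_csSup ?_ ⟨(⊤ : G.Subgraph).induce (S : Set V), by simpa using hS, by simp⟩
    refine Set.Finite.bddAbove ((Set.finite_range fun H : G.Subgraph =>
      2 * (H.edgeSet.ncard : ℝ) / (H.verts.ncard : ℝ)).subset ?_)
    rintro _ ⟨H, -, rfl⟩
    exact ⟨H, rfl⟩
  have hlt := hle.trans_lt hG
  have hc : (0 : ℝ) < #S := by exact_mod_cast hS.card_pos
  rw [div_lt_div_iff₀ hc (by positivity)] at hlt
  have hp : (G.adjPairs S : ℝ) * (3 * k + 1) < 8 * k * #S := by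
    rw [adjPairs_eq_two_mul_ncard]
    push_cast
    exact hlt
  have hp' : (G.adjPairs S : ℤ) * (3 * k + 1) < 8 * k * #S := by exact_mod_cast hp
  simp only [potential, Nat.cast_one, sub_self, mul_zero, sub_zero, sum_const, nsmul_eq_mul]
  linarith

end SimpleGraph

theorem mainTheorem3 (k : ℕ) (hk : 2 ≤ k) {V : Type*} [Finite V] (G : SimpleGraph V)
    (hG : G.mad < 8 * (k : ℝ) / (3 * (k : ℝ) + 1)) :
    G.AdmitsIOPartition k := by
  cases nonempty_fintype V
  obtain ⟨f, hf⟩ := SimpleGraph.exists_isIOColoring hk Finset.univ (fun _ => 1) (fun _ => le_rfl)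
    (fun S _ hS => SimpleGraph.potential_pos_of_mad_lt hG hS)
  exact hf.admitsIOPartition
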